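/- Let $a=(a_0,a_1,\ldots)$ be a sequence of real numbers, let $G(x)=\sum_{k\ge 0}a_kx^k$ be its formal generating function, and let $T$ be the infinite lower-triangular Toeplitz matrix with $T_{i,j}=a_{i-j}$ for $i\ge j$ and $T_{i,j}=0$ for $i<j$. The series $G$ is rational of degree at most $d$ if there are real polynomials $P,Q$ with $Q(0)\neq 0$, $\deg Q\le d$ and $\deg P\le d-1$ such that $Q\,G=P$ (for $d=0$ this means $P=0$, so $G=0$). It is rational of degree $d$ if $d\in\mathbb{N}$ is the least number with this property. A streaming algorithm consists of buffer sizes $\beta(t)\in\mathbb{N}$ for $t\ge -1$, with $\beta(-1)=1$, update maps $u^{(t)}:\mathbb{R}^{\beta(t-1)}\times\mathbb{R}\to\mathbb{R}^{\beta(t)}$ and output maps $m^{(t)}:\mathbb{R}^{\beta(t)}\to\mathbb{R}$ for $t\ge 0$. On a stream $z=(z_0,z_1,\ldots)$ of real numbers its states are $s^{(-1)}=0$ and $s^{(t)}=u^{(t)}(s^{(t-1)},z_t)$, and its output at time $t$ is $m^{(t)}(s^{(t)})$. It is required that for every $t$ the map $(z_0,\ldots,z_t)\mapsto s^{(t)}$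 is continuous; the output maps are arbitrary. For $t\in\mathbb{N}$ and $\tau\in\mathbb{N}\cup\{\infty\}$ with $\tau\ge t$, let $\mathsf{space}_a(t;\tau)$ be the least $b$ for which there is a streaming algorithm such that $m^{(t')}(s^{(t')})=(Tz)_{t'}$ for every stream $z$ and every time $t'\le\tau$, and such that $\beta(t')\le b$ for all $0\le t'\le t$. Write $\mathsf{space}_a(t)=\mathsf{space}_a(t;\infty)$. Theorem. If $G$ is rational of degree $d$, then $$\mathsf{space}_a(t)=d\quad\text{for every } t\ge d,\qquad\text{and}\qquad \mathsf{space}_a(t;\,t+d-1)=t+1\quad\text{for every } 0\le t<d.$$ -/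

import Mathlib

open scoped Polynomial PowerSeries

/-- The data of a streaming algorithm over the reals. Times are shifted by one so that the initial
time `-1` becomes index `0`: `size 0` is the size of the initial buffer, and `size (t + 1)` is the
size of the buffer once the input at time `t` has been processed. -/
structure StreamingMaps where
  /-- buffer sizes -/
  size : ℕ → ℕ
  /-- the initial buffer consists of one real number -/
  size_zero : size 0 = 1
  /-- the map that computes the state at time `t` from the previous state and the input `z t` -/
  update : (t : ℕ) → (Fin (size t) → ℝ) → ℝ → (Fin (size (t + 1)) → ℝ)
  /-- the map that computes the output at time `t` from the state at time `t` -/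
  output : (t : ℕ) → (Fin (size (t + 1)) → ℝ) → ℝ

namespace StreamingMaps

/-- The states of the algorithm on the stream `z`: `state z 0` is the initial state, namely zero,
and `state z (t + 1)` is the state at time `t`, after `z 0, …, z t` have been read. -/
def state (A : StreamingMaps) (z : ℕ → ℝ) : (k : ℕ) → (Fin (A.size k) → ℝ)
  | 0 => 0
  | t + 1 => A.update t (A.state z t) (z t)

/-- The buffer size at time `t`. -/
def bufferSize (A : StreamingMaps) (t : ℕ) : ℕ := A.size (t + 1)

/-- The output at time `t` on the stream `z`. -/
def outputAt (A : StreamingMaps) (z : ℕ → ℝ) (t : ℕ) : ℝ :=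
  A.output t (A.state z (t + 1))

end StreamingMaps

/-- The stream that begins with the `n` numbers in `w` and continues with zeros. -/
def streamOfPrefix {n : ℕ} (w : Fin n → ℝ) : ℕ → ℝ :=
  fun i => if h : i < n then w ⟨i, h⟩ else 0

/-- A streaming algorithm: for every time `t`, the map from `(z 0, …, z t)` to the state at time `t`
is continuous. The state at time `t` does not depend on later inputs, so it does not matter how
the finite sequence is continued. The output maps are arbitrary. -/
structure StreamingAlgorithm extends StreamingMaps where
  continuous_state : ∀ t : ℕ, Continuous fun w : Fin (t + 1) → ℝ =>
    toStreamingMaps.state (streamOfPrefix w) (t + 1)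

/-- The algorithm computes `M z` correctly up to time `τ` (at all times if `τ = ⊤`): for every
stream `z` and every time `t ≤ τ`, its output at time `t` is `(M z)_t = ∑ j, M t j * z j`. For a
lower-triangular matrix `M` this is a finite sum. -/
def StreamingAlgorithm.ComputesUpTo (A : StreamingAlgorithm) (M : Matrix ℕ ℕ ℝ) (τ : ℕ∞) : Prop :=
  ∀ z : ℕ → ℝ, ∀ t : ℕ, (t : ℕ∞) ≤ τ → HasSum (fun j => M t j * z j) (A.outputAt z t)

/-- The space complexity of `M` at time `t` with time horizon `τ`: the minimal `b` for which some
streaming algorithm computes `M` correctly up to time `τ` with buffer size at most `b` at all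
times `0, …, t` (and `⊤` if there is no such `b`). -/
noncomputable def streamingSpace (M : Matrix ℕ ℕ ℝ) (t : ℕ) (τ : ℕ∞) : ℕ∞ :=
  sInf {b : ℕ∞ | ∃ A : StreamingAlgorithm, A.ComputesUpTo M τ ∧
    ∀ t' ≤ t, (A.bufferSize t' : ℕ∞) ≤ b}

/-- The infinite lower-triangular Toeplitz matrix of the sequence `a`. -/
def toeplitzMatrix (a : ℕ → ℝ) : Matrix ℕ ℕ ℝ :=
  Matrix.of fun i j => if j ≤ i then a (i - j) else 0

/-- The generating function of `a` is a rational function of degree at most `d`: there are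
polynomials `P` and `Q`, where `Q` has a nonzero constant coefficient, `deg Q ≤ d` and
`deg P ≤ d - 1`, such that `Q * G = P`. The degree of the zero polynomial is `⊥`, so `P = 0` when
`d = 0`. -/
def RationalOfDegreeAtMost (a : ℕ → ℝ) (d : ℕ) : Prop :=
  ∃ P Q : ℝ[X], Q.coeff 0 ≠ 0 ∧ Q.degree ≤ d ∧ P.degree < d ∧
    (Q : ℝ⟦X⟧) * PowerSeries.mk a = (P : ℝ⟦X⟧)

/-- The generating function of `a` is a rational function of degree (exactly) `d`. -/
def RationalOfDegree (a : ℕ → ℝ) (d : ℕ) : Prop :=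
  RationalOfDegreeAtMost a d ∧ ∀ e < d, ¬ RationalOfDegreeAtMost a e

/-!
For the lower bound, suppose that `t < d` and consider the state at time `t` as a function of the
inputs `z 0, …, z t`. If the stream continues with zeros, the later outputs depend on the state only,
and the outputs at times `t, …, t + d - 1` are coefficients of `V * G`, where `V` is the polynomial
with coefficients `z 0, …, z t`. As `G` has degree exactly `d`, these coefficients determine `V`
(`eq_zero_of_window`), so the state is a continuous injective function on `ℝ ^ (t + 1)`. By the
invariance of dimension (`not_injective_of_finrank_lt`), the buffer has size at least `t + 1`. For
`t ≥ d` the bound at time `d - 1` is used.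

The invariance of dimension is derived from a degree formula: if `h` is a `C¹` map that is
the identity outside a ball `B`, then `∫_B φ(h) det Dh = ∫_B φ` for polynomial `φ`
(`integral_comp_mul_det_eq`). The formula holds for `(1 - t) id + t h` with small `t` by a change of
variables, and both sides are polynomials in `t`. A continuous injection into a space of
smaller dimension yields, after smoothing it and its inverse, such an `h` whose Jacobian vanishes
wherever `h` is near the origin; this contradicts the formula when `φ` is concentrated there.

For the upper bounds, an algorithm that stores its whole input uses `t + 1` numbers at time `t`
(`storageAlgorithm`), and a buffer of `d` numbers suffices at all times because the next `d` outputs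
under zero input can be updated with the linear recurrence that `a` satisfies
(`recurrenceAlgorithm`).
-/

/-! ### A degree formula for perturbations of the identity -/

open Module in
/-- Along the segment from the identity in the direction `A`, the determinant is a polynomial in the
parameter, of degree bounded independently of `A`. -/
theorem exists_polynomial_det_one_add_smul {E : Type*} [NormedAddCommGroup E] [NormedSpace ℝ E]
    [FiniteDimensional ℝ E] (A : E →L[ℝ] E) :
    ∃ p : ℝ[X], p.natDegree ≤ finrank ℝ E ∧
      ∀ t : ℝ, p.eval t = ((1 : E →L[ℝ] E) + t • A).det := by
  let b := finBasis ℝ E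
  let M := LinearMap.toMatrix b b (A : E →ₗ[ℝ] E)
  refine ⟨((Polynomial.X : ℝ[X]) • M.map Polynomial.C +
    (1 : Matrix _ _ ℝ).map Polynomial.C).det, ?_, fun t => ?_⟩
  · simpa using Polynomial.natDegree_det_X_add_C_le M 1
  · rw [ContinuousLinearMap.det, ← LinearMap.det_toMatrix b, ← Polynomial.coe_evalRingHom,
      RingHom.map_det]
    congr 1
    ext i j
    by_cases hij : i = j <;>
      simp [M, LinearMap.toMatrix_apply, hij, add_comm, mul_comm t]

open MeasureTheory in
/-- Integrals of a family that is pointwise polynomial in the parameter `t`, of bounded degree: if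
they take the same value for all small `t > 0`, they take it for all `t`. Lagrange interpolation
expresses the integrand at `t` through integrands at small parameters, so nothing need be known
about how the coefficients of the polynomials depend on the point. -/
theorem integral_eq_of_forall_small {α : Type*} [MeasurableSpace α] {μ : Measure α}
    {F : ℝ → α → ℝ} {D : ℕ} {C δ : ℝ} (hδ : 0 < δ)
    (hF : ∀ x, ∃ p : ℝ[X], p.natDegree ≤ D ∧ ∀ t, p.eval t = F t x)
    (hint : ∀ t, Integrable (F t) μ) (hC : ∀ t, 0 < t → t < δ → ∫ x, F t x ∂μ = C) (t : ℝ) :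
    ∫ x, F t x ∂μ = C := by
  -- `D + 1` distinct interpolation nodes, all in `(0, δ)`.
  set v : ℕ → ℝ := fun i => δ / (i + 2) with hv
  have hvs : Set.InjOn v (Finset.range (D + 1)) := by
    intro i _ j _ hij
    simp only [hv] at hij
    rw [div_eq_div_iff (by positivity) (by positivity)] at hij
    have := mul_left_cancel₀ hδ.ne' hij
    exact_mod_cast (by linarith : (i : ℝ) = j)
  have key : ∀ x, F t x =
      ∑ i ∈ Finset.range (D + 1), (Lagrange.basis (Finset.range (D + 1)) v i).eval t * F (v i) x := by
    intro x
    obtain ⟨p, hp, hpe⟩ := hF x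
    have hdeg : p.degree < (Finset.range (D + 1)).card := by
      rw [Finset.card_range]
      exact (Polynomial.degree_le_natDegree).trans_lt (by exact_mod_cast Nat.lt_succ_of_le hp)
    rw [← hpe t, Lagrange.eq_interpolate hvs hdeg, Lagrange.interpolate_apply,
      Polynomial.eval_finsetSum]
    refine Finset.sum_congr rfl fun i _ => ?_
    rw [Polynomial.eval_mul, Polynomial.eval_C, hpe, mul_comm]
  simp_rw [key]
  rw [integral_finsetSum _ fun i _ => (hint _).const_mul _]
  have hi : ∀ i, ∫ x, F (v i) x ∂μ = C := fun i =>
    hC _ (by positivity) (div_lt_self hδ (by linarith [(Nat.cast_nonneg i : (0:ℝ) ≤ i)]))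
  simp_rw [integral_const_mul, hi]
  rw [← Finset.sum_mul, ← Polynomial.eval_finsetSum, Lagrange.sum_basis hvs ⟨0, by simp⟩]
  simp

open MeasureTheory Metric Module in
/-- The degree formula `∫ φ(h) det Dh = ∫ φ` for a `C¹` map `h = id + u` that is the identity outside
a ball, with a test function `φ` that is polynomial along lines. For `id + t u` with small `t` this
is the change of variables formula, since `id + t u` is then a bijection of the ball with positive
Jacobian; both sides are polynomials in `t`, so it extends to `t = 1`. -/
theorem integral_comp_mul_det_eq {E : Type*} [NormedAddCommGroup E] [NormedSpace ℝ E]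
    [FiniteDimensional ℝ E] [MeasurableSpace E] [BorelSpace E] (μ : Measure E) [μ.IsAddHaarMeasure]
    {u : E → E} (hu : ContDiff ℝ 1 u) {R : ℝ} (hR : ∀ x, R ≤ ‖x‖ → u x = 0)
    {φ : E → ℝ} (hφ : Continuous φ) {D : ℕ}
    (hpoly : ∀ x v, ∃ p : ℝ[X], p.natDegree ≤ D ∧ ∀ t : ℝ, p.eval t = φ (x + t • v)) :
    ∫ x in closedBall 0 R, φ (x + u x) * ((1 : E →L[ℝ] E) + fderiv ℝ u x).det ∂μ =
      ∫ x in closedBall 0 R, φ x ∂μ := by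
  have hcs : HasCompactSupport u := by
    refine HasCompactSupport.of_support_subset_isCompact (isCompact_closedBall 0 R) fun x hx => ?_
    by_contra h
    exact hx (hR x (le_of_lt (by simpa using h)))
  obtain ⟨L, hL⟩ := hu.lipschitzWith_of_hasCompactSupport hcs (by simp)
  obtain ⟨K, hK⟩ : ∃ K, ∀ x, ‖fderiv ℝ u x‖ ≤ K :=
    (hcs.fderiv (𝕜 := ℝ)).exists_bound_of_continuous (hu.continuous_fderiv (by simp))
  have hdetc : Continuous fun A : E →L[ℝ] E => A.det := ContinuousLinearMap.continuous_det
  obtain ⟨η, hη, hdet⟩ : ∃ η > 0, ∀ A : E →L[ℝ] E, ‖A‖ < η → 0 < ((1 : E →L[ℝ] E) + A).det := by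
    have h1 : ∀ᶠ A in nhds (0 : E →L[ℝ] E), 0 < ((1 : E →L[ℝ] E) + A).det := by
      refine ((hdetc.comp (continuous_const.add continuous_id)).tendsto 0).eventually (lt_mem_nhds ?_)
      simp [ContinuousLinearMap.det]
    obtain ⟨η, hη, h⟩ := Metric.eventually_nhds_iff.1 h1
    exact ⟨η, hη, fun A hA => h (by simpa using hA)⟩
  have hdu : Differentiable ℝ u := hu.differentiable (by simp)
  have hfc : Continuous (fderiv ℝ u) := hu.continuous_fderiv (by simp)
  have key := integral_eq_of_forall_small (μ := μ.restrict (closedBall 0 R)) (D := D + finrank ℝ E)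
    (F := fun t x => φ (x + t • u x) * ((1 : E →L[ℝ] E) + t • fderiv ℝ u x).det)
    (C := ∫ x in closedBall 0 R, φ x ∂μ) (δ := min (1 / (L + 1)) (η / (|K| + 1)))
    (by positivity) ?_ ?_ ?_ 1
  · simpa using key
  · intro x
    obtain ⟨p, hp, hpe⟩ := hpoly x (u x)
    obtain ⟨q, hq, hqe⟩ := exists_polynomial_det_one_add_smul (fderiv ℝ u x)
    exact ⟨p * q, Polynomial.natDegree_mul_le.trans (add_le_add hp hq), fun t => by
      rw [Polynomial.eval_mul, hpe, hqe]⟩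
  · intro t
    have := hu.continuous
    have hc : Continuous fun x => φ (x + t • u x) * ((1 : E →L[ℝ] E) + t • fderiv ℝ u x).det :=
      Continuous.mul (by fun_prop) (hdetc.comp (by fun_prop))
    exact hc.continuousOn.integrableOn_compact
      (isCompact_closedBall 0 R)
  · intro t ht htδ
    have htL : t * L < 1 := by
      have := (lt_div_iff₀ (by positivity)).1 (htδ.trans_le (min_le_left _ _))
      nlinarith
    have htK : t * |K| < η := by
      have := (lt_div_iff₀ (by positivity)).1 (htδ.trans_le (min_le_right _ _))
      nlinarith
    set h : E → E := fun x => x + t • u x with hh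
    have happ : ApproximatesLinearOn h ((ContinuousLinearEquiv.refl ℝ E : E ≃L[ℝ] E) : E →L[ℝ] E)
        Set.univ (Real.toNNReal t * L) := by
      intro x _ y _
      have h2 := hL.dist_le_mul x y
      rw [dist_eq_norm, dist_eq_norm] at h2
      have : h x - h y - ((ContinuousLinearEquiv.refl ℝ E : E ≃L[ℝ] E) : E →L[ℝ] E) (x - y)
          = t • (u x - u y) := by
        simp [hh, smul_sub]; abel
      rw [this, norm_smul, Real.norm_of_nonneg ht.le]
      push_cast
      rw [Real.coe_toNNReal _ ht.le, mul_assoc]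
      gcongr
    have hc : Subsingleton E ∨ Real.toNNReal t * L <
        ‖((ContinuousLinearEquiv.refl ℝ E).symm : E →L[ℝ] E)‖₊⁻¹ := by
      rcases subsingleton_or_nontrivial E with hE | hE
      · exact Or.inl hE
      · right
        have : ‖((ContinuousLinearEquiv.refl ℝ E).symm : E →L[ℝ] E)‖₊ = 1 := by
          simp
        rw [this, inv_one, ← NNReal.coe_lt_coe]
        push_cast
        rwa [Real.coe_toNNReal _ ht.le]
    have hinj : Function.Injective h := Set.injOn_univ.1 (happ.injOn hc)
    have hsurj : Function.Surjective h := happ.surjective hc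
    have hout : ∀ x, R ≤ ‖x‖ → h x = x := fun x hx => by simp [hh, hR x hx]
    -- A bijection fixing every point outside the ball maps the ball onto itself.
    have himg : h '' closedBall 0 R = closedBall 0 R := by
      have h1 : h '' (closedBall 0 R)ᶜ = (closedBall 0 R)ᶜ := by
        have : Set.EqOn h id (closedBall 0 R)ᶜ := fun x hx => hout x (le_of_lt (by simpa using hx))
        rw [this.image_eq, Set.image_id]
      rw [Set.image_compl_eq ⟨hinj, hsurj⟩] at h1
      exact compl_injective h1
    have hcv := integral_image_eq_integral_abs_det_fderiv_smul μ
      (measurableSet_closedBall (x := (0 : E)) (ε := R)) (f := h)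
      (f' := fun x => (1 : E →L[ℝ] E) + t • fderiv ℝ u x)
      (fun x _ => ((hasFDerivAt_id x).add ((hdu x).hasFDerivAt.const_smul t)).hasFDerivWithinAt)
      hinj.injOn φ
    rw [himg] at hcv
    rw [hcv]
    refine integral_congr_ae (Filter.Eventually.of_forall fun x => ?_)
    have hpos : 0 < ((1 : E →L[ℝ] E) + t • fderiv ℝ u x).det := by
      refine hdet _ ?_
      rw [norm_smul, Real.norm_of_nonneg ht.le]
      exact (mul_le_mul_of_nonneg_left ((hK x).trans (le_abs_self K)) ht.le).trans_lt htK
    simp only [abs_of_pos hpos, smul_eq_mul, hh]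
    ring

/-! ### Continuous injections do not lower the dimension -/

open Metric in
/-- A continuous injection `f` has `C¹` approximations with an approximate `C¹` left inverse on a
given ball: `g` approximates a continuous extension of `f⁻¹`, and `f'` is then chosen close enough
to `f`, depending on the modulus of continuity of `g`. -/
theorem exists_contDiff_comp_dist_le {E F : Type*}
    [NormedAddCommGroup E] [NormedSpace ℝ E] [FiniteDimensional ℝ E]
    [NormedAddCommGroup F] [NormedSpace ℝ F] [FiniteDimensional ℝ F]
    {f : E → F} (hf : Continuous f) (hinj : Function.Injective f) (R : ℝ) {ε : ℝ} (hε : 0 < ε) :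
    ∃ (f' : E → F) (g : F → E), ContDiff ℝ 1 f' ∧ ContDiff ℝ 1 g ∧
      ∀ x ∈ closedBall (0 : E) R, dist (g (f' x)) x ≤ ε := by
  have : TietzeExtension E := TietzeExtension.of_tvs ℝ
  have : CompactSpace (closedBall (0 : E) R) :=
    isCompact_iff_compactSpace.1 (isCompact_closedBall 0 R)
  have hemb : Topology.IsClosedEmbedding fun x : closedBall (0 : E) R => f x :=
    (hf.comp continuous_subtype_val).isClosedEmbedding (hinj.comp Subtype.val_injective)
  obtain ⟨g₀, hg₀⟩ := ContinuousMap.exists_extension' hemb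
    (⟨Subtype.val, continuous_subtype_val⟩ : C(closedBall (0 : E) R, E))
  obtain ⟨g, hg, hgg₀, -⟩ := g₀.continuous.exists_contDiff_approx 1
    (ε := fun _ => ε / 2) continuous_const (fun _ => by positivity)
  have hunif := ((isCompact_closedBall (0 : E) R).image hf).uniformContinuousAt_of_continuousAt g
    (fun y _ => hg.continuous.continuousAt) (dist_mem_uniformity (half_pos hε))
  obtain ⟨δ, hδ, hδg⟩ := Metric.mem_uniformity_dist.1 hunif
  obtain ⟨f', hf', hff', -⟩ := hf.exists_contDiff_approx 1
    (ε := fun _ => δ) continuous_const (fun _ => hδ)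
  refine ⟨f', g, hf', hg, fun x hx => ?_⟩
  have h1 : dist (g (f x)) (g (f' x)) < ε / 2 :=
    hδg (by rw [dist_comm]; exact hff' x) (Set.mem_image_of_mem f hx)
  have h2 : dist (g (f x)) (g₀ (f x)) < ε / 2 := hgg₀ _
  have h3 : g₀ (f x) = x := congrFun hg₀ ⟨x, hx⟩
  rw [h3] at h2
  linarith [dist_triangle_left (g (f' x)) x (g (f x))]

open Module in
theorem det_comp_eq_zero_of_finrank_lt {E F : Type*}
    [NormedAddCommGroup E] [NormedSpace ℝ E] [FiniteDimensional ℝ E]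
    [NormedAddCommGroup F] [NormedSpace ℝ F] [FiniteDimensional ℝ F]
    (hdim : finrank ℝ F < finrank ℝ E) (B : F →L[ℝ] E) (A : E →L[ℝ] F) : (B.comp A).det = 0 := by
  by_contra h
  have h1 : Function.Injective ((B.comp A : E →L[ℝ] E) : E →ₗ[ℝ] E) :=
    ((LinearMap.isUnit_iff_isUnit_det _).2 (isUnit_iff_ne_zero.2 h) |>
      (Module.End.isUnit_iff _).1).injective
  have h2 : Function.Injective (A : E →ₗ[ℝ] F) := fun x y hxy => h1 (by
    have : A x = A y := hxy
    simp [this])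
  exact absurd (LinearMap.finrank_le_finrank_of_injective h2) (not_le.2 hdim)

open MeasureTheory Metric Module in
/-- There is no continuous injection into a space of smaller dimension. Otherwise some `C¹` map `H`
that factors through the smaller space, so that `det DH = 0`, is uniformly close to the identity on
a ball. Blend `H` into the identity near the boundary of the ball to obtain `h = id + u`: then
`det Dh` vanishes except where `h` stays away from the origin, and the degree formula fails for test
functions `φ` that concentrate at the origin. The functions `(1 - ‖y‖² / 16) ^ k` are such test
functions and are polynomial along lines. -/
theorem not_injective_of_finrank_lt {E F : Type*}
    [NormedAddCommGroup E] [InnerProductSpace ℝ E] [FiniteDimensional ℝ E]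
    [NormedAddCommGroup F] [NormedSpace ℝ F] [FiniteDimensional ℝ F]
    (hdim : finrank ℝ F < finrank ℝ E) {f : E → F} (hf : Continuous f) :
    ¬ Function.Injective f := by
  intro hinj
  borelize E
  let μ : Measure E := Measure.addHaar
  obtain ⟨f', g, hf', hg, hgf⟩ :=
    exists_contDiff_comp_dist_le hf hinj 3 (ε := 1 / 2) (by norm_num)
  set H : E → E := fun x => g (f' x) with hH
  have hHc : ContDiff ℝ 1 H := hg.comp hf'
  have hHdet : ∀ x, (fderiv ℝ H x).det = 0 := fun x => by
    have : fderiv ℝ H x = (fderiv ℝ g (f' x)).comp (fderiv ℝ f' x) :=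
      fderiv_comp x (hg.differentiable (by simp) _) (hf'.differentiable (by simp) _)
    rw [this]
    exact det_comp_eq_zero_of_finrank_lt hdim _ _
  let χ : ContDiffBump (0 : E) := ⟨2, 3, by norm_num, by norm_num⟩
  set u : E → E := fun x => χ x • (H x - x) with hu
  have huc : ContDiff ℝ 1 u := χ.contDiff.smul (hHc.sub contDiff_id)
  have hu0 : ∀ x, 3 ≤ ‖x‖ → u x = 0 := fun x hx => by
    have : χ x = 0 := χ.zero_of_le_dist (by simpa [χ] using hx)
    simp [hu, this]
  have hule : ∀ x ∈ closedBall (0 : E) 3, ‖u x‖ ≤ 1 / 2 := fun x hx => by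
    have h1 := hgf x hx
    rw [dist_eq_norm] at h1
    rw [hu, norm_smul, Real.norm_of_nonneg χ.nonneg]
    exact (mul_le_of_le_one_left (norm_nonneg _) χ.le_one).trans h1
  set J : E → ℝ := fun x => ((1 : E →L[ℝ] E) + fderiv ℝ u x).det with hJ
  have hJc : Continuous J := ContinuousLinearMap.continuous_det.comp
    (continuous_const.add (huc.continuous_fderiv (by simp)))
  have hJ0 : ∀ x, ‖x‖ < 2 → J x = 0 := fun x hx => by
    have hev : u =ᶠ[nhds x] fun y => H y - y := by
      filter_upwards [isOpen_ball.mem_nhds (show x ∈ ball (0 : E) 2 by simpa using hx)] with y hy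
      have : χ y = 1 := χ.one_of_mem_closedBall (ball_subset_closedBall hy)
      simp [hu, this]
    have : fderiv ℝ u x = fderiv ℝ H x - 1 := by
      rw [hev.fderiv_eq]
      exact ((hHc.differentiable (by simp) x).hasFDerivAt.sub (hasFDerivAt_id x)).fderiv
    rw [hJ]
    simp only [this, add_sub_cancel, hHdet]
  have hφc : ∀ k : ℕ, Continuous fun y : E => (1 - ‖y‖ ^ 2 / 16) ^ k := fun k => by fun_prop
  have hint : ∀ {G : E → ℝ}, Continuous G → IntegrableOn G (closedBall 0 3) μ := fun hG =>
    hG.continuousOn.integrableOn_compact (isCompact_closedBall 0 3)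
  have key : ∀ k : ℕ, ∫ x in closedBall 0 3, (1 - ‖x + u x‖ ^ 2 / 16) ^ k * J x ∂μ =
      ∫ x in closedBall 0 3, (1 - ‖x‖ ^ 2 / 16) ^ k ∂μ := fun k => by
    refine integral_comp_mul_det_eq μ huc hu0 (hφc k) (D := k * 2) fun x v => ?_
    refine ⟨(1 - (Polynomial.C (‖x‖ ^ 2) + Polynomial.C (2 * inner ℝ x v) * Polynomial.X +
      Polynomial.C (‖v‖ ^ 2) * Polynomial.X ^ 2) * Polynomial.C (1 / 16)) ^ k, ?_, fun t => ?_⟩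
    · refine Polynomial.natDegree_pow_le_of_le k ?_
      compute_degree
    · simp only [Polynomial.eval_pow, Polynomial.eval_sub, Polynomial.eval_one,
        Polynomial.eval_mul, Polynomial.eval_add, Polynomial.eval_C, Polynomial.eval_X]
      rw [norm_add_sq_real, inner_smul_right, norm_smul, mul_pow, Real.norm_eq_abs, sq_abs]
      ring
  -- The Jacobian is supported where `2 ≤ ‖x‖ ≤ 3`, and there `3 / 2 ≤ ‖x + u x‖ ≤ 4`; the value
  -- `55 / 64` is `1 - (3 / 2) ^ 2 / 16`.
  have hupper : ∀ k : ℕ, ∫ x in closedBall 0 3, (1 - ‖x + u x‖ ^ 2 / 16) ^ k * J x ∂μ ≤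
      (55 / 64) ^ k * ∫ x in closedBall 0 3, |J x| ∂μ := fun k => by
    rw [← integral_const_mul]
    have := huc.continuous
    refine setIntegral_mono_on (hint (by fun_prop)) (hint (by fun_prop))
      measurableSet_closedBall fun x hx => ?_
    rcases lt_or_ge ‖x‖ 2 with h2 | h2
    · simp [hJ0 x h2]
    · have hx3 : ‖x‖ ≤ 3 := by simpa using hx
      have h1 : ‖x + u x‖ ≤ 4 := by linarith [norm_add_le x (u x), hule x hx]
      have h3 : 3 / 2 ≤ ‖x + u x‖ := by
        have h := norm_sub_le (x + u x) (u x)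
        rw [add_sub_cancel_right] at h
        linarith [hule x hx]
      have h4 : 0 ≤ 1 - ‖x + u x‖ ^ 2 / 16 := by nlinarith [norm_nonneg (x + u x)]
      have h5 : 1 - ‖x + u x‖ ^ 2 / 16 ≤ 55 / 64 := by nlinarith
      calc _ ≤ (1 - ‖x + u x‖ ^ 2 / 16) ^ k * |J x| := by gcongr; exact le_abs_self _
        _ ≤ _ := by gcongr
  -- On the unit ball the test function is at least `(1 - 1 / 16) ^ k`.
  have hlower : ∀ k : ℕ, (15 / 16) ^ k * μ.real (closedBall 0 1) ≤
      ∫ x in closedBall 0 3, (1 - ‖x‖ ^ 2 / 16) ^ k ∂μ := fun k => by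
    have hsub : closedBall (0 : E) 1 ⊆ closedBall 0 3 := closedBall_subset_closedBall (by norm_num)
    calc (15 / 16) ^ k * μ.real (closedBall 0 1)
        = ∫ x in closedBall 0 1, (15 / 16 : ℝ) ^ k ∂μ := by
          rw [setIntegral_const, smul_eq_mul, mul_comm]
      _ ≤ ∫ x in closedBall 0 1, (1 - ‖x‖ ^ 2 / 16) ^ k ∂μ := by
          refine setIntegral_mono_on ((hint (by fun_prop)).mono_set hsub)
            ((hint (hφc k)).mono_set hsub) measurableSet_closedBall fun x hx => ?_
          have hx1 : ‖x‖ ≤ 1 := by simpa using hx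
          gcongr
          nlinarith [norm_nonneg x]
      _ ≤ _ := by
          refine setIntegral_mono_set (hint (hφc k)) ?_ hsub.eventuallyLE
          filter_upwards [ae_restrict_mem measurableSet_closedBall] with x hx
          have hx3 : ‖x‖ ≤ 3 := by simpa using hx
          exact pow_nonneg (by nlinarith [norm_nonneg x]) k
  have hvol : 0 < μ.real (closedBall (0 : E) 1) :=
    ENNReal.toReal_pos (measure_closedBall_pos μ 0 one_pos).ne' measure_closedBall_lt_top.ne
  set C := ∫ x in closedBall 0 3, |J x| ∂μ
  -- The ratio of the two rates is `(55 / 64) / (15 / 16) = 11 / 12 < 1`.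
  have hbound : ∀ k : ℕ, μ.real (closedBall (0 : E) 1) ≤ (11 / 12) ^ k * C := fun k => by
    have h1 := ((hlower k).trans (key k).ge).trans (hupper k)
    have h2 : (55 / 64 : ℝ) ^ k = (15 / 16) ^ k * (11 / 12) ^ k := by
      rw [← mul_pow]; norm_num
    rw [h2, mul_assoc] at h1
    exact le_of_mul_le_mul_left h1 (by positivity)
  have hlim : Filter.Tendsto (fun k : ℕ => (11 / 12 : ℝ) ^ k * C) Filter.atTop (nhds (0 * C)) :=
    (tendsto_pow_atTop_nhds_zero_of_lt_one (by norm_num) (by norm_num)).mul_const C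
  have := ge_of_tendsto' hlim hbound
  linarith

theorem not_injective_fin_of_lt {m n : ℕ} (hmn : m < n) {f : (Fin n → ℝ) → (Fin m → ℝ)}
    (hf : Continuous f) : ¬ Function.Injective f := by
  intro hinj
  have e := EuclideanSpace.equiv (Fin n) ℝ
  refine not_injective_of_finrank_lt (E := EuclideanSpace ℝ (Fin n)) (F := Fin m → ℝ)
    (by simpa using hmn) (hf.comp e.continuous) (hinj.comp e.injective)

/-! ### Windows of coefficients of a rational series -/

/-- If `V` has degree at most `t`, the coefficients of `V * G` from `t + d` on satisfy the recurrence of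
order `d` given by the denominator of `G`. Hence, if the `d` coefficients from `t` to `t + d - 1`
vanish, so do all later ones. -/
theorem coeff_eq_zero_of_window {a : ℕ → ℝ} {d t : ℕ} (hG : RationalOfDegreeAtMost a d) {V : ℝ[X]}
    (hV : V.degree < (t + 1 : ℕ))
    (hw : ∀ i < d, PowerSeries.coeff (t + i) ((V : ℝ⟦X⟧) * PowerSeries.mk a) = 0) (k : ℕ)
    (hk : t ≤ k) : PowerSeries.coeff k ((V : ℝ⟦X⟧) * PowerSeries.mk a) = 0 := by
  obtain ⟨P, Q, hQ0, hQ, hP, hPQ⟩ := hG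
  induction k using Nat.strong_induction_on with
  | _ k ih =>
    by_cases hkd : k < t + d
    · obtain ⟨i, rfl⟩ := Nat.exists_eq_add_of_le hk
      exact hw i (by omega)
    have h0 : PowerSeries.coeff k ((Q : ℝ⟦X⟧) * ((V : ℝ⟦X⟧) * PowerSeries.mk a)) = 0 := by
      rw [mul_left_comm, hPQ, PowerSeries.coeff_mul]
      refine Finset.sum_eq_zero fun ij hij => ?_
      rw [Finset.HasAntidiagonal.mem_antidiagonal] at hij
      rw [Polynomial.coeff_coe, Polynomial.coeff_coe]
      by_cases hi : ij.1 < t + 1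
      · rw [Polynomial.coeff_eq_zero_of_degree_lt
          (hP.trans_le (Nat.cast_le.2 (show d ≤ ij.2 by omega))), mul_zero]
      · rw [Polynomial.coeff_eq_zero_of_degree_lt
          (hV.trans_le (Nat.cast_le.2 (show t + 1 ≤ ij.1 by omega))), zero_mul]
    rw [PowerSeries.coeff_mul, Finset.sum_eq_single (0, k)] at h0
    · simpa [hQ0] using h0
    · rintro ⟨i, j⟩ hij hne
      rw [Finset.HasAntidiagonal.mem_antidiagonal] at hij
      have hi : i ≠ 0 := by
        rintro rfl
        exact hne (by simpa using hij)
      by_cases hid : i ≤ d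
      · rw [ih j (by simp at hij; omega) (by simp at hij; omega), mul_zero]
      · rw [Polynomial.coeff_coe, Polynomial.coeff_eq_zero_of_degree_lt
          (hQ.trans_lt (Nat.cast_lt.2 (not_le.1 hid))), zero_mul]
    · simp

/-- The Hankel-type map that sends the coefficients of `V` to the coefficients of `V * G` at
`t, …, t + d - 1` is injective for `t < d` when the degree of `G` is exactly `d`: if these
coefficients vanish, `V * G` is a polynomial of degree less than `t`, so that `G` has a denominator
of degree at most `t < d`. -/
theorem eq_zero_of_window {a : ℕ → ℝ} {d t : ℕ} (hG : RationalOfDegree a d) (ht : t < d) {V : ℝ[X]}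
    (hV : V.degree < (t + 1 : ℕ))
    (hw : ∀ i < d, PowerSeries.coeff (t + i) ((V : ℝ⟦X⟧) * PowerSeries.mk a) = 0) : V = 0 := by
  by_contra hV0
  have hc := coeff_eq_zero_of_window hG.1 hV hw
  -- A denominator must have a nonzero constant coefficient, so the largest power of `X` dividing `V`
  -- is cancelled.
  set m := V.natTrailingDegree with hm
  have hmt : m ≤ t := V.natTrailingDegree_le_natDegree.trans
    (Nat.lt_succ_iff.1 ((Polynomial.natDegree_lt_iff_degree_lt hV0).2 hV))
  obtain ⟨W, hW⟩ : Polynomial.X ^ m ∣ V :=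
    Polynomial.X_pow_dvd_iff.2 fun i hi => Polynomial.coeff_eq_zero_of_lt_natTrailingDegree hi
  have hWc : ∀ k, W.coeff k = V.coeff (k + m) := fun k => by
    rw [hW, Polynomial.coeff_X_pow_mul]
  have hWG : ∀ k, PowerSeries.coeff k ((W : ℝ⟦X⟧) * PowerSeries.mk a) =
      PowerSeries.coeff (k + m) ((V : ℝ⟦X⟧) * PowerSeries.mk a) := fun k => by
    rw [hW, Polynomial.coe_mul, Polynomial.coe_pow, Polynomial.coe_X, mul_assoc,
      PowerSeries.coeff_X_pow_mul]
  refine hG.2 (t - m) (by omega) ⟨PowerSeries.trunc (t - m) ((W : ℝ⟦X⟧) * PowerSeries.mk a), W,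
    ?_, ?_, PowerSeries.degree_trunc_lt _ _, ?_⟩
  · rw [hWc, zero_add]
    exact Polynomial.trailingCoeff_nonzero_iff_nonzero.2 hV0
  · refine (Polynomial.degree_le_iff_coeff_zero _ _).2 fun k hk => ?_
    have hk' : t - m < k := Nat.cast_lt.1 hk
    rw [hWc]
    exact Polynomial.coeff_eq_zero_of_degree_lt
      (hV.trans_le (Nat.cast_le.2 (show t + 1 ≤ k + m by omega)))
  · ext k
    rw [Polynomial.coeff_coe, PowerSeries.coeff_trunc]
    split_ifs with h
    · rfl
    · rw [hWG, hc _ (by omega)]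

/-! ### The lower bound -/

theorem hasSum_toeplitzMatrix (a z : ℕ → ℝ) (s : ℕ) :
    HasSum (fun j => toeplitzMatrix a s j * z j) (∑ j ∈ Finset.range (s + 1), a (s - j) * z j) := by
  have h : ∑ j ∈ Finset.range (s + 1), a (s - j) * z j =
      ∑ j ∈ Finset.range (s + 1), toeplitzMatrix a s j * z j :=
    Finset.sum_congr rfl fun j hj => by
      simp [toeplitzMatrix, Nat.lt_succ_iff.1 (Finset.mem_range.1 hj)]
  rw [h]
  refine hasSum_sum_of_ne_finset_zero fun j hj => ?_
  have : ¬ j ≤ s := by simpa [Nat.lt_succ_iff] using hj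
  simp [toeplitzMatrix, this]

theorem coeff_mk_mul_mk (a z : ℕ → ℝ) (s : ℕ) :
    PowerSeries.coeff s (PowerSeries.mk z * PowerSeries.mk a) =
      ∑ j ∈ Finset.range (s + 1), a (s - j) * z j := by
  rw [PowerSeries.coeff_mul, Finset.Nat.sum_antidiagonal_eq_sum_range_succ_mk]
  simp [mul_comm]

theorem StreamingMaps.state_eq_of_state_eq (A : StreamingMaps) {z z' : ℕ → ℝ} {t : ℕ}
    (h : A.state z t = A.state z' t) (hz : ∀ i, t ≤ i → z i = z' i) (k : ℕ) (hk : t ≤ k) :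
    A.state z k = A.state z' k := by
  induction k, hk using Nat.le_induction with
  | base => exact h
  | succ k hk ih => rw [StreamingMaps.state, StreamingMaps.state, ih, hz k hk]

/-- The state at time `t < d` determines the inputs read so far: continued with zeros, they give the
outputs at times `t, …, t + d - 1`, which determine the inputs by `eq_zero_of_window`. -/
theorem StreamingAlgorithm.injective_state {a : ℕ → ℝ} {d : ℕ} (hG : RationalOfDegree a d)
    {A : StreamingAlgorithm} {t : ℕ} (ht : t < d) {τ : ℕ∞} (hτ : ((t + d - 1 : ℕ) : ℕ∞) ≤ τ)
    (hA : A.ComputesUpTo (toeplitzMatrix a) τ) :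
    Function.Injective fun w : Fin (t + 1) → ℝ => A.state (streamOfPrefix w) (t + 1) := by
  intro w w' hww
  set z := streamOfPrefix w with hz
  set z' := streamOfPrefix w' with hz'
  have hz0 : ∀ i, t + 1 ≤ i → z i = z' i := fun i hi => by
    simp [hz, hz', streamOfPrefix, not_lt.2 hi]
  have hcoe : ((PowerSeries.trunc (t + 1) (PowerSeries.mk (z - z')) : ℝ[X]) : ℝ⟦X⟧) =
      PowerSeries.mk (z - z') := by
    ext k
    rw [Polynomial.coeff_coe, PowerSeries.coeff_trunc]
    split_ifs with h
    · rfl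
    · simp [hz0 k (by omega)]
  have hV := eq_zero_of_window hG ht
    (PowerSeries.degree_trunc_lt (PowerSeries.mk (z - z')) (t + 1)) fun i hi => by
      have hle : ((t + i : ℕ) : ℕ∞) ≤ τ :=
        le_trans (Nat.cast_le.2 (show t + i ≤ t + d - 1 by omega)) hτ
      have h1 := (hA z (t + i) hle).unique (hasSum_toeplitzMatrix a z (t + i))
      have h2 := (hA z' (t + i) hle).unique (hasSum_toeplitzMatrix a z' (t + i))
      have h3 : A.outputAt z (t + i) = A.outputAt z' (t + i) := by
        rw [StreamingMaps.outputAt, StreamingMaps.outputAt,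
          A.state_eq_of_state_eq hww hz0 (t + i + 1) (by omega)]
      rw [hcoe, coeff_mk_mul_mk]
      simp only [Pi.sub_apply, mul_sub, Finset.sum_sub_distrib]
      rw [← h1, ← h2, h3, sub_self]
  rw [hV] at hcoe
  funext i
  have h := congrArg (PowerSeries.coeff i.1) hcoe
  simpa [hz, hz', streamOfPrefix, Nat.lt_succ_iff.1 i.2, eq_comm, sub_eq_zero] using h

theorem StreamingAlgorithm.lt_bufferSize {a : ℕ → ℝ} {d : ℕ} (hG : RationalOfDegree a d)
    {A : StreamingAlgorithm} {t : ℕ} (ht : t < d) {τ : ℕ∞} (hτ : ((t + d - 1 : ℕ) : ℕ∞) ≤ τ)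
    (hA : A.ComputesUpTo (toeplitzMatrix a) τ) : t < A.bufferSize t := by
  by_contra h
  exact not_injective_fin_of_lt (Nat.lt_succ_of_le (not_lt.1 h)) (A.continuous_state t)
    (A.injective_state hG ht hτ hA)

/-! ### Optimal algorithms -/

theorem continuous_streamOfPrefix (n i : ℕ) :
    Continuous fun w : Fin n → ℝ => streamOfPrefix w i := by
  unfold streamOfPrefix
  split_ifs <;> fun_prop

/-- The maps that store all inputs read so far. At time `t` the buffer has size `t + 1`; the maximum
with `1` accounts for the initial buffer. -/
noncomputable def storageMaps (a : ℕ → ℝ) : StreamingMaps where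
  size k := max 1 k
  size_zero := rfl
  update t s x i := if h : i.1 < t then s ⟨i, lt_max_of_lt_right h⟩ else x
  output t s := ∑ i, a (t - i.1) * s i

theorem storageMaps_state (a z : ℕ → ℝ) (t : ℕ) (i : Fin (max 1 (t + 1))) :
    (storageMaps a).state z (t + 1) i = z i := by
  induction t with
  | zero =>
    simp [StreamingMaps.state, storageMaps]
  | succ t ih =>
    rw [StreamingMaps.state]
    by_cases h : i.1 < t + 1
    · simp only [storageMaps, h, dite_true]
      exact ih _
    · have : i.1 = t + 1 := by have := i.2; omega
      simp [storageMaps, this]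

/-- The streaming algorithm that stores its whole input. -/
noncomputable def storageAlgorithm (a : ℕ → ℝ) : StreamingAlgorithm where
  toStreamingMaps := storageMaps a
  continuous_state t := continuous_pi fun (i : Fin (max 1 (t + 1))) =>
    (continuous_streamOfPrefix (t + 1) i).congr fun w =>
      (storageMaps_state a (streamOfPrefix w) t i).symm

theorem storageAlgorithm_computesUpTo (a : ℕ → ℝ) (τ : ℕ∞) :
    (storageAlgorithm a).ComputesUpTo (toeplitzMatrix a) τ := by
  intro z t _
  convert! hasSum_toeplitzMatrix a z t using 1
  change ∑ i : Fin (max 1 (t + 1)), a (t - i.1) * (storageMaps a).state z (t + 1) i = _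
  simp only [storageMaps_state]
  rw [Fin.sum_univ_eq_sum_range (fun i => a (t - i) * z i), max_eq_right (by omega)]

/-- The coefficients of a rational series of degree at most `d` satisfy a linear recurrence of order
`d`, which holds from the start since the numerator has degree less than `d`. -/
theorem RationalOfDegreeAtMost.exists_recurrence {a : ℕ → ℝ} {d : ℕ}
    (hG : RationalOfDegreeAtMost a d) :
    ∃ c : ℕ → ℝ, ∀ k, a (k + d) = ∑ j ∈ Finset.range d, c j * a (k + j) := by
  obtain ⟨P, Q, hQ0, hQ, hP, hPQ⟩ := hG
  refine ⟨fun j => -(Q.coeff (d - j) / Q.coeff 0), fun k => ?_⟩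
  have h := congrArg (PowerSeries.coeff (k + d)) hPQ
  rw [Polynomial.coeff_coe, Polynomial.coeff_eq_zero_of_degree_lt
      (hP.trans_le (Nat.cast_le.2 (Nat.le_add_left d k))), PowerSeries.coeff_mul,
    Finset.Nat.sum_antidiagonal_eq_sum_range_succ_mk,
    ← Finset.sum_subset (Finset.range_mono (show d + 1 ≤ (k + d).succ by omega))] at h
  · rw [Finset.sum_range_succ', ← Finset.sum_range_reflect] at h
    simp only [Polynomial.coeff_coe, PowerSeries.coeff_mk, Nat.sub_zero] at h
    have h2 : ∀ j ∈ Finset.range d, Q.coeff (d - 1 - j + 1) * a (k + d - (d - 1 - j + 1)) =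
        Q.coeff (d - j) * a (k + j) := fun j hj => by
      rw [Finset.mem_range] at hj
      rw [show d - 1 - j + 1 = d - j by omega, show k + d - (d - j) = k + j by omega]
    rw [Finset.sum_congr rfl h2] at h
    simp only [neg_mul, Finset.sum_neg_distrib, div_mul_eq_mul_div, ← Finset.sum_div]
    field_simp
    linarith
  · intro i _ hi
    rw [Finset.mem_range, not_lt] at hi
    rw [Polynomial.coeff_coe, Polynomial.coeff_eq_zero_of_degree_lt
      (hQ.trans_lt (Nat.cast_lt.2 hi)), zero_mul]

/-- The output at time `t + i` if the stream is `z` up to time `t` and zero afterwards. -/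
noncomputable def zeroInputResponse (a z : ℕ → ℝ) (t i : ℕ) : ℝ :=
  ∑ j ∈ Finset.range (t + 1), a (t + i - j) * z j

theorem zeroInputResponse_succ (a z : ℕ → ℝ) (t i : ℕ) :
    zeroInputResponse a z (t + 1) i = zeroInputResponse a z t (i + 1) + a i * z (t + 1) := by
  rw [zeroInputResponse, Finset.sum_range_succ, Nat.add_sub_cancel_left]
  simp only [zeroInputResponse, show t + 1 + i = t + (i + 1) by omega]

theorem zeroInputResponse_recurrence {a c : ℕ → ℝ} {d : ℕ}
    (hc : ∀ k, a (k + d) = ∑ j ∈ Finset.range d, c j * a (k + j)) (z : ℕ → ℝ) (t : ℕ) :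
    zeroInputResponse a z t d = ∑ j ∈ Finset.range d, c j * zeroInputResponse a z t j := by
  simp only [zeroInputResponse, Finset.mul_sum]
  rw [Finset.sum_comm]
  refine Finset.sum_congr rfl fun i hi => ?_
  have hi' : i ≤ t := Nat.lt_succ_iff.1 (Finset.mem_range.1 hi)
  rw [Nat.sub_add_comm hi', hc, Finset.sum_mul]
  refine Finset.sum_congr rfl fun j _ => ?_
  rw [Nat.sub_add_comm hi', mul_assoc]

/-- The maps whose state after time `t` consists of the next `d` outputs under zero input,
`zeroInputResponse a z t i` for `i < d`. An update shifts them, obtains the last one from the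
recurrence with coefficients `c`, and adds the response to the new input. -/
noncomputable def recurrenceMaps (a c : ℕ → ℝ) (d : ℕ) : StreamingMaps where
  size
    | 0 => 1
    | _ + 1 => d
  size_zero := rfl
  update
    | 0 => fun _ x i => a i.1 * x
    | _ + 1 => fun s x i =>
      (if h : i.1 + 1 < d then s ⟨i.1 + 1, h⟩ else ∑ j : Fin d, c j.1 * s j) + a i.1 * x
  output _ s := if h : 0 < d then s ⟨0, h⟩ else 0

theorem recurrenceMaps_state {a c : ℕ → ℝ} {d : ℕ}
    (hc : ∀ k, a (k + d) = ∑ j ∈ Finset.range d, c j * a (k + j)) (z : ℕ → ℝ) (t : ℕ) (i : Fin d) :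
    (recurrenceMaps a c d).state z (t + 1) i = zeroInputResponse a z t i := by
  induction t generalizing i with
  | zero => simp [StreamingMaps.state, recurrenceMaps, zeroInputResponse]
  | succ t ih =>
    rw [zeroInputResponse_succ]
    change (if h : i.1 + 1 < d then (recurrenceMaps a c d).state z (t + 1) ⟨i.1 + 1, h⟩
      else ∑ j : Fin d, c j.1 * (recurrenceMaps a c d).state z (t + 1) j) + a i.1 * z (t + 1) = _
    congr 1
    split_ifs with h
    · exact ih _
    · rw [show i.1 + 1 = d by have := i.2; omega, zeroInputResponse_recurrence hc,
        ← Fin.sum_univ_eq_sum_range (fun j => c j * zeroInputResponse a z t j)]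
      exact Finset.sum_congr rfl fun j _ => congrArg (c j.1 * ·) (ih j)

/-- The streaming algorithm with buffers of size `d` for a sequence `a` that satisfies the linear
recurrence of order `d` with coefficients `c`. -/
noncomputable def recurrenceAlgorithm {a c : ℕ → ℝ} {d : ℕ}
    (hc : ∀ k, a (k + d) = ∑ j ∈ Finset.range d, c j * a (k + j)) : StreamingAlgorithm where
  toStreamingMaps := recurrenceMaps a c d
  continuous_state t := continuous_pi fun (i : Fin d) =>
    (continuous_finsetSum (Finset.range (t + 1)) fun j _ =>
      continuous_const.mul (continuous_streamOfPrefix (t + 1) j)).congr fun w =>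
        (recurrenceMaps_state hc (streamOfPrefix w) t i).symm

theorem recurrenceAlgorithm_computesUpTo {a c : ℕ → ℝ} {d : ℕ}
    (hc : ∀ k, a (k + d) = ∑ j ∈ Finset.range d, c j * a (k + j)) (τ : ℕ∞) :
    (recurrenceAlgorithm hc).ComputesUpTo (toeplitzMatrix a) τ := by
  intro z t _
  convert! hasSum_toeplitzMatrix a z t using 1
  change (if h : 0 < d then (recurrenceMaps a c d).state z (t + 1) ⟨0, h⟩ else 0) = _
  split_ifs with h
  · exact recurrenceMaps_state hc z t ⟨0, h⟩
  -- For `d = 0` the recurrence says `a = 0`, and the empty buffer suffices.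
  · obtain rfl : d = 0 := by omega
    have ha : ∀ k, a k = 0 := fun k => by simpa using hc k
    simp [ha]

/-! ### The space complexity -/

theorem theorem1 (a : ℕ → ℝ) (d : ℕ) (hG : RationalOfDegree a d) :
    (∀ t : ℕ, d ≤ t → streamingSpace (toeplitzMatrix a) t ⊤ = (d : ℕ∞)) ∧
    (∀ t : ℕ, t < d →
      streamingSpace (toeplitzMatrix a) t ((t + d - 1 : ℕ) : ℕ∞) = ((t + 1 : ℕ) : ℕ∞)) := by
  obtain ⟨c, hc⟩ := hG.1.exists_recurrence
  refine ⟨fun t ht => le_antisymm ?_ ?_, fun t ht => le_antisymm ?_ ?_⟩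
  · exact sInf_le ⟨recurrenceAlgorithm hc, recurrenceAlgorithm_computesUpTo hc ⊤, fun _ _ => le_rfl⟩
  · refine le_sInf ?_
    rintro b ⟨A, hA, hb⟩
    rcases Nat.eq_zero_or_pos d with rfl | hd
    · simp
    -- The buffer is already large at time `d - 1 ≤ t`.
    have h := A.lt_bufferSize hG (Nat.sub_lt hd one_pos) le_top hA
    exact le_trans (Nat.cast_le.2 (by omega)) (hb (d - 1) (by omega))
  · refine sInf_le ⟨storageAlgorithm a, storageAlgorithm_computesUpTo a _, fun t' ht' => ?_⟩
    exact Nat.cast_le.2 (show max 1 (t' + 1) ≤ t + 1 by omega)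
  · refine le_sInf ?_
    rintro b ⟨A, hA, hb⟩
    exact le_trans (Nat.cast_le.2 (A.lt_bufferSize hG ht le_rfl hA)) (hb t le_rfl)
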